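/- Let $\mathcal F$ be the fermionic Fock space: the complex vector space with basis the formal semi-infinite wedges $v_{i_0}\wedge v_{i_1}\wedge v_{i_2}\wedge\cdots$, where $i_0>i_1>i_2>\cdots$ are integers with $i_k=-k$ for all sufficiently large $k$. For a sequence of integers $(s_k)_{k\ge 0}$ with $s_k=-k$ for large $k$, not necessarily decreasing, $v_{s_0}\wedge v_{s_1}\wedge\cdots$ denotes the element of $\mathcal F$ that is $0$ if two of the $s_k$ coincide, and otherwise is the sign of the permutation sorting the sequence into decreasing order times the corresponding basis wedge. For $i,j\in\mathbb Z$ the matrix unit $E_{i,j}$ (with $E_{i,j}v_l=\delta_{j,l}v_i$) acts on $\mathcal F$ by the Leibniz rule $$E_{i,j}(v_{i_0}\wedge v_{i_1}\wedge\cdots)=\sum_{m\ge 0}v_{i_0}\wedge\cdots\wedge v_{i_{m-1}}\wedge E_{i,j}v_{i_m}\wedge v_{i_{m+1}}\wedge\cdots .$$ For $k\ne 0$ let $\Lambda_k=\sum_{i\in\mathbb Z}E_{i,i+k}$, a well-defined operator on $\mathcal F$ (only finitely many terms act nontrivially on any given basis wedge), and set $\Lambda_0=0$ on $\mathcal F$.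 Let $v_\varnothing=v_0\wedge v_{-1}\wedge v_{-2}\wedge\cdots$. Let $H=\bigoplus_{k\in\mathbb Z}\mathbb C a_k\oplus\mathbb C z$ be the Heisenberg Lie algebra, with $[z,a_k]=0$ and $[a_n,a_k]=n\,\delta_{n,-k}\,z$. Let $\mathcal B=\mathbb C[x_1,x_2,\dots]$ be the bosonic Fock space, the $H$-module on which $a_n$ acts by $\partial/\partial x_n$ and $a_{-n}$ by multiplication by $n x_n$ for $n>0$, $a_0$ acts by $0$, and $z$ acts by the identity. **Theorem (Boson-Fermion Correspondence).** The assignment $a_k\mapsto\Lambda_k$ $(k\in\mathbb Z)$, $z\mapsto\operatorname{id}$ makes $\mathcal F$ an $H$-module. There is a unique isomorphism of $H$-modules $\sigma:\mathcal F\to\mathcal B$ with $\sigma(v_\varnothing)=1$. In particular, $\mathcal F$ is irreducible as an $H$-module. -/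

import Mathlib

noncomputable section

namespace BosonFermion

/-! ### The Heisenberg algebra -/

/-- The underlying vector space `⨁_{k ∈ ℤ} ℂ a_k ⊕ ℂ z` of the Heisenberg algebra. -/
def Heisenberg : Type := (ℤ →₀ ℂ) × ℂ

namespace Heisenberg

instance : AddCommGroup Heisenberg := inferInstanceAs (AddCommGroup ((ℤ →₀ ℂ) × ℂ))

instance : Module ℂ Heisenberg := inferInstanceAs (Module ℂ ((ℤ →₀ ℂ) × ℂ))

/-- The generator `a_k`. -/
def a (k : ℤ) : Heisenberg := (Finsupp.single k 1, 0)

/-- The central generator `z`. -/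
def z : Heisenberg := (0, 1)

/-- The bilinear form `(f, g) ↦ ∑ n, n f(n) g(-n)`, the coefficient of `z` in the bracket. -/
def form (f g : ℤ →₀ ℂ) : ℂ := f.sum fun n c => (n : ℂ) * c * g (-n)

lemma form_add_left (f f' g : ℤ →₀ ℂ) : form (f + f') g = form f g + form f' g := by
  classical
  unfold form
  rw [Finsupp.sum_add_index'] <;> intros <;> ring

lemma form_add_right (f g g' : ℤ →₀ ℂ) : form f (g + g') = form f g + form f g' := by
  unfold form
  rw [← Finsupp.sum_add]
  refine Finsupp.sum_congr fun n _ => ?_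
  simp only [Finsupp.add_apply]
  ring

lemma form_smul_right (t : ℂ) (f g : ℤ →₀ ℂ) : form f (t • g) = t * form f g := by
  unfold form
  rw [Finsupp.mul_sum]
  refine Finsupp.sum_congr fun n _ => ?_
  simp only [Finsupp.smul_apply, smul_eq_mul]
  ring

@[simp] lemma form_zero_left (g : ℤ →₀ ℂ) : form 0 g = 0 := by simp [form]

@[simp] lemma form_zero_right (f : ℤ →₀ ℂ) : form f 0 = 0 := by simp [form]

lemma form_self (f : ℤ →₀ ℂ) : form f f = 0 := by
  have key : form f f = ∑ᶠ n : ℤ, (n : ℂ) * f n * f (-n) := by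
    unfold form Finsupp.sum
    rw [finsum_eq_sum_of_support_subset]
    intro n hn
    simp only [Function.mem_support] at hn
    simp only [Finset.mem_coe, Finsupp.mem_support_iff]
    rintro h
    simp [h] at hn
  have h2 : (∑ᶠ n : ℤ, (n : ℂ) * f n * f (-n)) = ∑ᶠ n : ℤ, -((n : ℂ) * f n * f (-n)) := by
    rw [← finsum_comp_equiv (Equiv.neg ℤ)]
    refine finsum_congr fun n => ?_
    simp only [Equiv.neg_apply, neg_neg, Int.cast_neg]
    ring
  rw [finsum_neg_distrib] at h2
  rw [key]
  exact self_eq_neg.mp h2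

/-- The Lie bracket: `z` is central and `[a_n, a_k] = n δ_{n,-k} z`
(see `bracket_a_a` and `bracket_z`). -/
instance : Bracket Heisenberg Heisenberg := ⟨fun x y => (0, form x.1 y.1)⟩

lemma bracket_def (x y : Heisenberg) : ⁅x, y⁆ = ((0, form x.1 y.1) : (ℤ →₀ ℂ) × ℂ) := rfl

instance : LieRing Heisenberg where
  add_lie _ _ _ := Prod.ext (add_zero _).symm (form_add_left _ _ _)
  lie_add _ _ _ := Prod.ext (add_zero _).symm (form_add_right _ _ _)
  lie_self x := Prod.ext rfl (form_self _)
  leibniz_lie x y w := by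
    refine Prod.ext (add_zero _).symm ?_
    change form x.1 0 = form 0 w.1 + form y.1 0
    simp

instance : LieAlgebra ℂ Heisenberg where
  lie_smul t _ _ := Prod.ext (smul_zero t).symm (form_smul_right _ _ _)

lemma bracket_a_a (n k : ℤ) : ⁅a n, a k⁆ = if n = -k then (n : ℂ) • z else 0 := by
  rw [bracket_def]
  simp only [a, form]
  rw [Finsupp.sum_single_index (by simp)]
  split_ifs with h
  · refine Prod.ext (smul_zero (n : ℂ)).symm ?_
    change (n : ℂ) * 1 * (Finsupp.single k (1 : ℂ)) (-n) = (n : ℂ) * 1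
    simp [h]
  · refine Prod.ext rfl ?_
    change (n : ℂ) * 1 * (Finsupp.single k (1 : ℂ)) (-n) = 0
    rw [Finsupp.single_eq_of_ne (by omega)]
    simp

lemma bracket_z (x : Heisenberg) : ⁅z, x⁆ = 0 := Prod.ext rfl (form_zero_left x.1)

end Heisenberg

/-! ### The bosonic Fock space -/

/-- The vector space `ℂ[x_1, x_2, …]`, to be equipped with the action of the Heisenberg
algebra of weight `(α, ζ)`. -/
def Bosonic (_α _ζ : ℂ) : Type := MvPolynomial ℕ+ ℂ

namespace Bosonic

variable (α ζ : ℂ)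

instance : CommRing (Bosonic α ζ) := inferInstanceAs (CommRing (MvPolynomial ℕ+ ℂ))

instance : Algebra ℂ (Bosonic α ζ) := inferInstanceAs (Algebra ℂ (MvPolynomial ℕ+ ℂ))

/-- The operator by which `a_k` acts: `∂/∂x_n` for `k = n > 0`, multiplication by `ζ n x_n`
for `k = -n < 0`, and `α • id` for `k = 0`. -/
def op : ℤ → MvPolynomial ℕ+ ℂ →ₗ[ℂ] MvPolynomial ℕ+ ℂ
  | Int.ofNat 0 => α • LinearMap.id
  | Int.ofNat (n + 1) => (MvPolynomial.pderiv (R := ℂ) n.succPNat).toLinearMap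
  | Int.negSucc n =>
      (ζ * ((n : ℂ) + 1)) • LinearMap.mulLeft ℂ (MvPolynomial.X n.succPNat : MvPolynomial ℕ+ ℂ)

lemma op_pos (n : ℕ+) (p : MvPolynomial ℕ+ ℂ) :
    op α ζ (n : ℤ) p = MvPolynomial.pderiv n p := by
  obtain ⟨m, rfl⟩ : ∃ m : ℕ, n = m.succPNat := ⟨n.natPred, by simp⟩
  rfl

lemma op_neg (n : ℕ+) (p : MvPolynomial ℕ+ ℂ) :
    op α ζ (-(n : ℤ)) p = (ζ * (n : ℂ)) • (MvPolynomial.X n * p) := by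
  obtain ⟨m, rfl⟩ : ∃ m : ℕ, n = m.succPNat := ⟨n.natPred, by simp⟩
  change (ζ * ((m : ℂ) + 1)) • (MvPolynomial.X m.succPNat * p) = _
  simp

lemma op_zero (p : MvPolynomial ℕ+ ℂ) : op α ζ 0 p = α • p := rfl

lemma op_comm (n k : ℤ) (p : MvPolynomial ℕ+ ℂ) :
    op α ζ n (op α ζ k p) - op α ζ k (op α ζ n p) = if n = -k then ((n : ℂ) * ζ) • p else 0 := by
  classical
  have hcomm : ∀ (i j : ℕ+) (q : MvPolynomial ℕ+ ℂ),
      MvPolynomial.pderiv i (MvPolynomial.pderiv j q)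
        = MvPolynomial.pderiv j (MvPolynomial.pderiv i q) := by
    intro i j q
    have h : ⁅MvPolynomial.pderiv (R := ℂ) i, MvPolynomial.pderiv (R := ℂ) j⁆ = 0 := by
      apply MvPolynomial.derivation_ext
      intro l
      simp [Derivation.commutator_apply, MvPolynomial.pderiv_X, Pi.single_apply, apply_ite]
    have := congrArg (fun D => D q) h
    simpa [Derivation.commutator_apply, sub_eq_zero] using this
  have hsign : ∀ n : ℤ, n = 0 ∨ (∃ m : ℕ+, n = m) ∨ ∃ m : ℕ+, n = -(m : ℤ) := by
    intro n
    rcases lt_trichotomy n 0 with h | h | h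
    · refine Or.inr (Or.inr ⟨⟨n.natAbs, by omega⟩, ?_⟩)
      simp only [PNat.mk_coe]
      omega
    · exact Or.inl h
    · refine Or.inr (Or.inl ⟨⟨n.natAbs, by omega⟩, ?_⟩)
      simp only [PNat.mk_coe]
      omega
  rcases hsign n with rfl | ⟨n, rfl⟩ | ⟨n, rfl⟩ <;> rcases hsign k with rfl | ⟨k, rfl⟩ | ⟨k, rfl⟩
  · simp
  · simp [op_zero]
  · simp [op_zero]
  · simp [op_zero]
  · have : (n : ℤ) ≠ -(k : ℤ) := by have := n.pos; have := k.pos; omega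
    rw [if_neg this, op_pos, op_pos, op_pos, op_pos, hcomm, sub_self]
  · simp only [op_pos, op_neg, map_smul, Derivation.leibniz, MvPolynomial.pderiv_X, neg_neg,
      smul_eq_mul]
    by_cases h : n = k
    · subst h
      simp only [Pi.single_eq_same, if_true, smul_add, mul_one, Int.cast_natCast]
      rw [add_sub_cancel_left, mul_comm]
    · have h' : (n : ℤ) ≠ (k : ℤ) := by exact_mod_cast h
      simp [h', Ne.symm h]
  · simp [op_zero]
  · simp only [op_pos, op_neg, map_smul, Derivation.leibniz, MvPolynomial.pderiv_X,
      smul_eq_mul]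
    by_cases h : n = k
    · subst h
      simp only [Pi.single_eq_same, if_true, smul_add, mul_one, Int.cast_neg, Int.cast_natCast]
      rw [sub_add_cancel_left, mul_comm ζ, neg_mul, neg_smul]
    · have h' : -(n : ℤ) ≠ -(k : ℤ) := by
        intro h2
        exact h (by exact_mod_cast neg_injective h2)
      simp [h', h]
  · have : -(n : ℤ) ≠ - -(k : ℤ) := by have := n.pos; have := k.pos; omega
    rw [if_neg this]
    simp only [op_neg, mul_smul_comm, sub_eq_zero]
    rw [smul_comm, mul_left_comm]

/-- The action of the Heisenberg algebra as a linear map: `a_k` acts by `op α ζ k`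
and `z` acts by `ζ • id`. -/
def rep : Heisenberg →ₗ[ℂ] Module.End ℂ (MvPolynomial ℕ+ ℂ) :=
  (Finsupp.linearCombination ℂ (op α ζ)).coprod
    (LinearMap.toSpanSingleton ℂ (Module.End ℂ (MvPolynomial ℕ+ ℂ)) (ζ • LinearMap.id))

lemma rep_apply (x : Heisenberg) (p : MvPolynomial ℕ+ ℂ) :
    rep α ζ x p = Finsupp.linearCombination ℂ (op α ζ) x.1 p + (x.2 * ζ) • p := by
  change (Finsupp.linearCombination ℂ (op α ζ) x.1 +
    x.2 • (ζ • LinearMap.id : Module.End ℂ (MvPolynomial ℕ+ ℂ))) p = _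
  simp [mul_smul]

lemma linearCombination_op_comm (f g : ℤ →₀ ℂ) (p : MvPolynomial ℕ+ ℂ) :
    Finsupp.linearCombination ℂ (op α ζ) f (Finsupp.linearCombination ℂ (op α ζ) g p)
      - Finsupp.linearCombination ℂ (op α ζ) g (Finsupp.linearCombination ℂ (op α ζ) f p)
      = (Heisenberg.form f g * ζ) • p := by
  induction f using Finsupp.induction_linear with
  | zero => simp
  | add f f' hf hf' =>
    rw [Heisenberg.form_add_left, add_mul, add_smul, ← hf, ← hf']
    simp only [map_add, LinearMap.add_apply]
    abel
  | single n c =>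
    induction g using Finsupp.induction_linear with
    | zero => simp
    | add g g' hg hg' =>
      rw [Heisenberg.form_add_right, add_mul, add_smul, ← hg, ← hg']
      simp only [map_add, LinearMap.add_apply]
      abel
    | single k d =>
      simp only [Finsupp.linearCombination_single, LinearMap.smul_apply, map_smul]
      rw [smul_comm d c, ← smul_sub, ← smul_sub, op_comm, Heisenberg.form,
        Finsupp.sum_single_index (by simp)]
      split_ifs with h
      · rw [h]
        simp only [neg_neg, Finsupp.single_eq_same, smul_smul]
        congr 1
        ring
      · rw [Finsupp.single_eq_of_ne (by omega)]
        simp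

lemma rep_lie (x y : Heisenberg) (p : MvPolynomial ℕ+ ℂ) :
    rep α ζ ⁅x, y⁆ p = rep α ζ x (rep α ζ y p) - rep α ζ y (rep α ζ x p) := by
  have h := linearCombination_op_comm α ζ x.1 y.1 p
  have e : rep α ζ ⁅x, y⁆ p = (Heisenberg.form x.1 y.1 * ζ) • p := by
    rw [rep_apply, Heisenberg.bracket_def]
    simp
  rw [e, ← h]
  simp only [rep_apply, map_add, map_smul, smul_add, smul_comm (x.2 * ζ) (y.2 * ζ) p]
  abel

instance : LieRingModule Heisenberg (Bosonic α ζ) where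
  bracket x p := rep α ζ x p
  add_lie x y p := by
    change rep α ζ (x + y) p = _
    rw [map_add]; rfl
  lie_add x p q := map_add (rep α ζ x) p q
  leibniz_lie x y p := sub_eq_iff_eq_add.1 (rep_lie α ζ x y p).symm

instance : LieModule ℂ Heisenberg (Bosonic α ζ) where
  smul_lie t x p := by
    change rep α ζ (t • x) p = _
    rw [map_smul]; rfl
  lie_smul t x p := map_smul (rep α ζ x) t p

lemma rep_a (k : ℤ) : rep α ζ (Heisenberg.a k) = op α ζ k := by
  refine LinearMap.ext fun p => ?_
  rw [rep_apply]
  simp only [Heisenberg.a, Finsupp.linearCombination_single, one_smul, zero_mul, zero_smul,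
    add_zero]

lemma rep_z : rep α ζ Heisenberg.z = ζ • LinearMap.id := by
  refine LinearMap.ext fun p => ?_
  rw [rep_apply]
  simp only [Heisenberg.z, map_zero, LinearMap.zero_apply, zero_add, one_mul]
  rfl

lemma lie_a (k : ℤ) (p : Bosonic α ζ) : ⁅Heisenberg.a k, p⁆ = op α ζ k p :=
  LinearMap.congr_fun (rep_a α ζ k) p

lemma lie_z (p : Bosonic α ζ) : ⁅Heisenberg.z, p⁆ = ζ • p :=
  LinearMap.congr_fun (rep_z α ζ) p

end Bosonic

/-! ### The fermionic Fock space -/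

/-- The labels of the semi-infinite wedges `v_{i_0} ∧ v_{i_1} ∧ v_{i_2} ∧ ⋯`: the sequences
`i_0 > i_1 > i_2 > ⋯` of integers with `i_k = -k` for all large `k`. -/
def WedgeIndex : Type :=
  {i : ℕ → ℤ // StrictAnti i ∧ ∀ᶠ k in Filter.atTop, i k = -(k : ℤ)}

/-- The fermionic Fock space: the complex vector space with basis the semi-infinite wedges. -/
abbrev Fermionic : Type := WedgeIndex →₀ ℂ

/-- A strictly decreasing sequence is determined by the set of its terms. -/
lemma WedgeIndex.ext_range {w w' : WedgeIndex} (h : Set.range w.1 = Set.range w'.1) : w = w' := by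
  refine Subtype.ext ?_
  have h1 : StrictMono (fun k => OrderDual.toDual (w.1 k)) := fun _ _ hab => w.2.1 hab
  have h2 : StrictMono (fun k => OrderDual.toDual (w'.1 k)) := fun _ _ hab => w'.2.1 hab
  have h3 := (StrictMono.range_inj h1 h2).1 (by
    change Set.range (OrderDual.toDual ∘ w.1) = Set.range (OrderDual.toDual ∘ w'.1)
    rw [Set.range_comp, Set.range_comp, h])
  exact funext fun k => OrderDual.toDual.injective (congrFun h3 k)

/-- A sequence of distinct integers that agrees with `-k` for large `k` can be sorted. -/
lemma WedgeIndex.exists_range_eq {s : ℕ → ℤ} (hs : Function.Injective s)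
    (he : ∀ᶠ k in Filter.atTop, s k = -(k : ℤ)) :
    ∃ w : WedgeIndex, Set.range w.1 = Set.range s := by
  classical
  obtain ⟨N, hN⟩ := Filter.eventually_atTop.1 he
  set T : Finset ℤ := (Finset.range N).image s with hT
  have hcard : T.card = N := by
    rw [hT, Finset.card_image_of_injective _ hs, Finset.card_range]
  have hlow : ∀ t ∈ T, -(N : ℤ) < t := by
    intro t ht
    obtain ⟨m, hm, rfl⟩ := Finset.mem_image.1 ht
    rw [Finset.mem_range] at hm
    by_contra hcon
    have h1 := hN (-(s m)).toNat (by omega)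
    have h2 : s (-(s m)).toNat = s m := by rw [h1]; omega
    have h3 := hs h2
    omega
  let e := T.orderEmbOfFin hcard
  let w : ℕ → ℤ := fun k => if h : k < N then e (Fin.rev ⟨k, h⟩) else -(k : ℤ)
  have hw1 : ∀ k (h : k < N), w k = e (Fin.rev ⟨k, h⟩) := fun k h => dif_pos h
  have hw2 : ∀ k, N ≤ k → w k = -(k : ℤ) := fun k h => dif_neg (by omega)
  have hemem : ∀ k, e k ∈ T := fun k => T.orderEmbOfFin_mem hcard k
  refine ⟨⟨w, ?_, Filter.eventually_atTop.2 ⟨N, hw2⟩⟩, ?_⟩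
  · intro i j hij
    by_cases hj : j < N
    · rw [hw1 j hj, hw1 i (hij.trans hj)]
      exact e.strictMono (by rw [Fin.rev_lt_rev]; exact hij)
    · rw [hw2 j (by omega)]
      by_cases hi : i < N
      · rw [hw1 i hi]
        have := hlow _ (hemem (Fin.rev ⟨i, hi⟩))
        omega
      · rw [hw2 i (by omega)]
        omega
  · ext t
    constructor
    · rintro ⟨k, rfl⟩
      by_cases hk : k < N
      · obtain ⟨m, _, hm⟩ := Finset.mem_image.1 (hemem (Fin.rev ⟨k, hk⟩))
        exact ⟨m, hm.trans (hw1 k hk).symm⟩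
      · exact ⟨k, (hN k (by omega)).trans (hw2 k (by omega)).symm⟩
    · rintro ⟨k, rfl⟩
      by_cases hk : k < N
      · have hmem : s k ∈ Set.range e := by
          rw [Finset.range_orderEmbOfFin]
          exact Finset.mem_image_of_mem s (Finset.mem_range.2 hk)
        obtain ⟨j, hj⟩ := hmem
        refine ⟨(Fin.rev j).1, ?_⟩
        change w _ = _
        rw [hw1 _ (Fin.rev j).2, ← hj]
        exact congrArg e (Fin.rev_rev j)
      · exact ⟨k, (hw2 k (by omega)).trans (hN k (by omega)).symm⟩

open Classical in
/-- The semi-infinite wedge `v_{s 0} ∧ v_{s 1} ∧ ⋯`, for `s` with `s k = -k` for large `k` whose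
terms need not be decreasing: it vanishes if a factor is repeated, and otherwise it is the basis
vector of the sorted sequence times the sign of the sorting permutation, that is `(-1)` to the
number of inversions. -/
def wedge (s : ℕ → ℤ) : Fermionic :=
  if h : Function.Injective s ∧ ∃ w : WedgeIndex, Set.range w.1 = Set.range s then
    Finsupp.single h.2.choose ((-1) ^ {p : ℕ × ℕ | p.1 < p.2 ∧ s p.1 < s p.2}.ncard)
  else 0

lemma wedge_of_not_injective {s : ℕ → ℤ} (hs : ¬ Function.Injective s) : wedge s = 0 :=
  dif_neg fun h => hs h.1

lemma wedge_eq {s : ℕ → ℤ} (hs : Function.Injective s) {w : WedgeIndex}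
    (hw : Set.range w.1 = Set.range s) :
    wedge s =
      Finsupp.single w ((-1) ^ {p : ℕ × ℕ | p.1 < p.2 ∧ s p.1 < s p.2}.ncard) := by
  have h : Function.Injective s ∧ ∃ w : WedgeIndex, Set.range w.1 = Set.range s := ⟨hs, w, hw⟩
  rw [wedge, dif_pos h, WedgeIndex.ext_range (h.2.choose_spec.trans hw.symm)]

/-- The number of inversions in the definition of `wedge` is finite. -/
lemma inversions_finite {s : ℕ → ℤ} (he : ∀ᶠ k in Filter.atTop, s k = -(k : ℤ)) :
    {p : ℕ × ℕ | p.1 < p.2 ∧ s p.1 < s p.2}.Finite := by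
  obtain ⟨N, hN⟩ := Filter.eventually_atTop.1 he
  obtain ⟨M, hM⟩ : ∃ M : ℕ, ∀ i < N, -(s i) ≤ M := by
    refine ⟨∑ i ∈ Finset.range N, (s i).natAbs, fun i hi => ?_⟩
    have := Finset.single_le_sum (f := fun i => (s i).natAbs) (fun _ _ => Nat.zero_le _)
      (Finset.mem_range.2 hi)
    omega
  refine ((Set.finite_lt_nat N).prod (Set.finite_lt_nat (N + M))).subset ?_
  rintro ⟨i, j⟩ ⟨hij, hs⟩
  simp only at hij hs
  have hi : i < N := by
    by_contra hi
    rw [hN i (by omega), hN j (by omega)] at hs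
    omega
  refine ⟨hi, ?_⟩
  change j < N + M
  by_contra hj
  rw [hN j (by omega)] at hs
  have := hM i hi
  omega

lemma wedge_of_index (w : WedgeIndex) : wedge w.1 = Finsupp.single w 1 := by
  rw [wedge_eq w.2.1.injective rfl]
  have : {p : ℕ × ℕ | p.1 < p.2 ∧ w.1 p.1 < w.1 p.2} = ∅ := by
    ext p
    simp only [Set.mem_ofPred_eq, Set.mem_empty_iff_false, iff_false, not_and, not_lt]
    exact fun h => (w.2.1 h).le
  simp [this]

/-- The vacuum label `0 > -1 > -2 > ⋯`. -/
def vacuumIndex : WedgeIndex :=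
  ⟨fun k => -(k : ℤ), fun i j h => by simpa using h, Filter.Eventually.of_forall fun _ => rfl⟩

/-- The vacuum vector `v_∅ = v_0 ∧ v_{-1} ∧ v_{-2} ∧ ⋯`. -/
def vacuum : Fermionic := Finsupp.single vacuumIndex 1

/-- The action of the matrix unit `E_{i,j}` (with `E_{i,j} v_l = δ_{j,l} v_i`) on the fermionic
Fock space by the Leibniz rule:
`E_{i,j} (v_{w 0} ∧ v_{w 1} ∧ ⋯) = ∑_m v_{w 0} ∧ ⋯ ∧ E_{i,j} v_{w m} ∧ ⋯`. -/
def E (i j : ℤ) : Fermionic →ₗ[ℂ] Fermionic :=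
  Finsupp.linearCombination ℂ fun w : WedgeIndex =>
    ∑ᶠ m : ℕ, if w.1 m = j then wedge (Function.update w.1 m i) else 0

/-- The action of the diagonal `Λ_k = ∑_i E_{i,i+k}` on the fermionic Fock space for `k ≠ 0`,
and zero for `k = 0`. On each basis vector the sum has finitely many nonzero terms,
see `finite_support_E`. -/
def Lam (k : ℤ) : Fermionic →ₗ[ℂ] Fermionic :=
  if k = 0 then 0 else
    Finsupp.linearCombination ℂ fun w : WedgeIndex =>
      ∑ᶠ i : ℤ, E i (i + k) (Finsupp.single w 1)

/-- At most one slot contributes to the action of `E_{i,j}` on a basis vector. -/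
lemma E_single (i j : ℤ) (w : WedgeIndex) (m : ℕ) (hm : w.1 m = j) :
    E i j (Finsupp.single w 1) = wedge (Function.update w.1 m i) := by
  simp only [E, Finsupp.linearCombination_single, one_smul]
  rw [finsum_eq_single _ m, if_pos hm]
  intro m' hm'
  refine if_neg fun h => hm' (w.2.1.injective (h.trans hm.symm))

lemma E_single_of_forall_ne (i j : ℤ) (w : WedgeIndex) (h : ∀ m, w.1 m ≠ j) :
    E i j (Finsupp.single w 1) = 0 := by
  simp [E, Finsupp.linearCombination_single, h]

/-- The sum defining `Λ_k` on a basis vector is finite when `k ≠ 0`. -/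
lemma finite_support_E {k : ℤ} (hk : k ≠ 0) (w : WedgeIndex) :
    (Function.support fun i : ℤ => E i (i + k) (Finsupp.single w 1)).Finite := by
  obtain ⟨N, hN⟩ := Filter.eventually_atTop.1 w.2.2
  refine ((Set.finite_lt_nat (N + k.natAbs)).image fun m => w.1 m - k).subset ?_
  intro i hi
  rw [Function.mem_support] at hi
  by_cases h : ∃ m, w.1 m = i + k
  · obtain ⟨m, hm⟩ := h
    rw [E_single i (i + k) w m hm] at hi
    refine ⟨m, ?_, by simp [hm]⟩
    change m < N + k.natAbs
    by_contra hlt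
    refine hi (wedge_of_not_injective fun hinj => ?_)
    have hm1 := hN m (by omega)
    obtain ⟨l, hl⟩ : ∃ l : ℕ, (l : ℤ) = m + k := ⟨(m + k).toNat, by omega⟩
    have hlm : l ≠ m := by omega
    have hl1 := hN l (by omega)
    refine hlm (hinj ?_)
    rw [Function.update_self, Function.update_of_ne hlm]
    omega
  · push Not at h
    exact absurd (E_single_of_forall_ne i (i + k) w h) hi

end BosonFermion

end

noncomputable section

namespace BosonFermion

/-! Applying `Λ_n Λ_k` to a wedge sums over pairs of slots `(m, l)`, one shifted by `-k` and the
other by `-n`. This is symmetric in the two operators, so the commutator could only come from the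
infinite tail. Truncating to `m < M`, `l < M'` makes that visible: the squares `m, l < M` cancel,
and in the strip `m < M ≤ l` the only nonzero terms occur for `n = -k`, where the two shifts
exchange two tail slots and give `-v`. Counting them gives the central term (`Lam_comm`). Working
with unsorted wedges requires antisymmetry of `wedge` (`wedge_comp_swap`), which yields the Leibniz
rule `Lam_wedge`.

The isomorphism is built in the direction `𝓑 → 𝓕`, as `p ↦ p(Λ_{-1}, Λ_{-2}/2, …) v_∅`
(`toFermionic`). Since `Λ_n v_∅ = 0` for `n > 0`, the commutation relations turn `Λ_n` into
`∂/∂x_n`. The kernel is closed under derivatives, so if it were nonzero it would contain `1`, which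
maps to `v_∅ ≠ 0`.

Surjectivity is a dimension count. A wedge encodes the partition `λ_k = i_k + k` of its energy, and
the differences `λ_{n-1} - λ_n` are the exponents of a monomial of weight `|λ|`. Hence there are at
most as many wedges of energy `d` as monomials of weight `d`, while the images of these monomials
are independent vectors of energy `d` (`energySubmodule_le_range`).

Uniqueness and irreducibility hold because `1` generates `𝓑` and lies in every nonzero submodule. -/

/-! ### Antisymmetry of the wedge. -/

/-- The sequences `s` with `s k = -k` for all large `k`. -/
def EventuallyNeg (s : ℕ → ℤ) : Prop := ∀ᶠ k in Filter.atTop, s k = -(k : ℤ)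

lemma EventuallyNeg.update {s : ℕ → ℤ} (hs : EventuallyNeg s) (m : ℕ) (x : ℤ) :
    EventuallyNeg (Function.update s m x) := by
  filter_upwards [hs, Filter.eventually_gt_atTop m] with k hk hm
  rw [Function.update_of_ne (by omega), hk]

lemma EventuallyNeg.comp_swap {s : ℕ → ℤ} (hs : EventuallyNeg s) (a b : ℕ) :
    EventuallyNeg (s ∘ Equiv.swap a b) := by
  filter_upwards [hs, Filter.eventually_gt_atTop a, Filter.eventually_gt_atTop b] with k hk ha hb
  rw [Function.comp_apply, Equiv.swap_apply_of_ne_of_ne (by omega) (by omega), hk]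

lemma eventuallyNeg_comp_swap_iff {s : ℕ → ℤ} (a b : ℕ) :
    EventuallyNeg (s ∘ Equiv.swap a b) ↔ EventuallyNeg s :=
  ⟨fun h => by simpa [Function.comp_def] using h.comp_swap a b, fun h => h.comp_swap a b⟩

lemma injective_comp_equiv_iff {s : ℕ → ℤ} (π : Equiv.Perm ℕ) :
    Function.Injective (s ∘ π) ↔ Function.Injective s :=
  Function.Injective.of_comp_iff' s π.bijective

/-- The terms of an injective sequence before its tail `-N, -N-1, …` lie above the tail. -/
lemma neg_lt_of_injective {s : ℕ → ℤ} (hs : Function.Injective s) {N : ℕ}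
    (hN : ∀ k, N ≤ k → s k = -(k : ℤ)) {i : ℕ} (hi : i < N) : -(N : ℤ) < s i := by
  by_contra hcon
  have h1 := hN (-(s i)).toNat (by omega)
  have h3 : (-(s i)).toNat = i := hs (by omega)
  omega

/-- The inversion sign of an injective sequence is the sign of a Vandermonde determinant. -/
lemma neg_one_pow_inversions {s : ℕ → ℤ} (hs : Function.Injective s) {N : ℕ}
    (hN : ∀ k, N ≤ k → s k = -(k : ℤ)) :
    (-1 : ℤ) ^ {p : ℕ × ℕ | p.1 < p.2 ∧ s p.1 < s p.2}.ncard =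
      Int.sign (Matrix.vandermonde fun i : Fin N => -s i).det := by
  classical
  set F : Finset (Σ _ : Fin N, Fin N) :=
    (Finset.univ.sigma fun i => Finset.Ioi i).filter fun p => s p.1 < s p.2 with hF
  have hset : {p : ℕ × ℕ | p.1 < p.2 ∧ s p.1 < s p.2} =
      ↑(F.image fun p => ((p.1 : ℕ), (p.2 : ℕ))) := by
    ext ⟨i, j⟩
    simp only [Set.mem_ofPred_eq, Finset.coe_image, Set.mem_image, Finset.mem_coe, hF,
      Finset.mem_filter, Finset.mem_sigma, Finset.mem_univ, Finset.mem_Ioi, true_and]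
    constructor
    · rintro ⟨hij, hlt⟩
      have hi : i < N := by
        by_contra hi
        rw [hN i (by omega), hN j (by omega)] at hlt
        omega
      have hj : j < N := by
        by_contra hj
        rw [hN j (by omega)] at hlt
        have := neg_lt_of_injective hs hN hi
        omega
      exact ⟨⟨⟨i, hi⟩, ⟨j, hj⟩⟩, ⟨hij, hlt⟩, rfl⟩
    · rintro ⟨⟨a, b⟩, ⟨hab, hlt⟩, h⟩
      simp only [Prod.mk.injEq] at h
      obtain ⟨rfl, rfl⟩ := h
      exact ⟨hab, hlt⟩
  have hinj : Function.Injective fun p : (Σ _ : Fin N, Fin N) => ((p.1 : ℕ), (p.2 : ℕ)) := by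
    rintro ⟨a, b⟩ ⟨c, d⟩ h
    simp only [Prod.mk.injEq, Fin.val_inj] at h
    obtain ⟨rfl, rfl⟩ := h
    rfl
  -- With nodes `-s i`, the Vandermonde factor for `i < j` is `s i - s j`, which is negative exactly
  -- at the inversions.
  rw [hset, Set.ncard_coe_finset, Finset.card_image_of_injective _ hinj, Matrix.det_vandermonde,
    Finset.prod_sigma']
  have hsign : ∀ (T : Finset (Σ _ : Fin N, Fin N)) (f : (Σ _ : Fin N, Fin N) → ℤ),
      Int.sign (∏ p ∈ T, f p) = ∏ p ∈ T, Int.sign (f p) := by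
    intro T f
    induction T using Finset.induction_on with
    | empty => simp
    | insert p T hp ih => rw [Finset.prod_insert hp, Finset.prod_insert hp, Int.sign_mul, ih]
  rw [hsign, hF, ← Finset.prod_const, Finset.prod_filter]
  refine Finset.prod_congr rfl fun p hp => ?_
  simp only [Finset.mem_sigma, Finset.mem_univ, Finset.mem_Ioi, true_and] at hp
  split_ifs with h
  · exact (Int.sign_eq_neg_one_of_neg (by omega)).symm
  · have hne : s p.1 ≠ s p.2 := fun h => by
      have := hs h
      rw [Fin.val_inj] at this
      exact absurd this hp.ne
    exact (Int.sign_eq_one_of_pos (by omega)).symm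

/-- The wedge is antisymmetric. -/
lemma wedge_comp_swap {s : ℕ → ℤ} (he : EventuallyNeg s) {a b : ℕ} (hab : a ≠ b) :
    wedge (s ∘ Equiv.swap a b) = -wedge s := by
  by_cases hs : Function.Injective s
  · have hs' := (injective_comp_equiv_iff (Equiv.swap a b)).2 hs
    obtain ⟨w, hw⟩ := WedgeIndex.exists_range_eq hs he
    have hw' : Set.range w.1 = Set.range (s ∘ Equiv.swap a b) := by
      rw [hw, EquivLike.range_comp]
    rw [wedge_eq hs hw, wedge_eq hs' hw', ← Finsupp.single_neg]
    congr 1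
    obtain ⟨N₀, hN₀⟩ := Filter.eventually_atTop.1 he
    set N := max N₀ (max (a + 1) (b + 1)) with hN
    have h1 : ∀ k, N ≤ k → s k = -(k : ℤ) := fun k hk => hN₀ k (by omega)
    have h2 : ∀ k, N ≤ k → (s ∘ Equiv.swap a b) k = -(k : ℤ) := fun k hk => by
      rw [Function.comp_apply, Equiv.swap_apply_of_ne_of_ne (by omega) (by omega), h1 k hk]
    -- `N` exceeds both `a` and `b`, so the swap exchanges two rows of the matrix.
    have key : (Matrix.vandermonde fun i : Fin N => -(s ∘ Equiv.swap a b) i).det =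
        -(Matrix.vandermonde fun i : Fin N => -s i).det := by
      have ha : a < N := by omega
      have hb : b < N := by omega
      have h := Matrix.det_permute (Equiv.swap (⟨a, ha⟩ : Fin N) ⟨b, hb⟩)
        (Matrix.vandermonde fun i : Fin N => -s i)
      rw [Equiv.Perm.sign_swap (by simpa using hab)] at h
      simp only [Units.val_neg, Units.val_one, Int.cast_neg, Int.cast_one, neg_mul,
        one_mul] at h
      rw [← h]
      congr 1
      ext i j
      simp only [Matrix.vandermonde_apply, Function.comp_apply, Matrix.submatrix_apply, id]
      congr 3
      simp only [Equiv.swap_apply_def, Fin.ext_iff]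
      split_ifs <;> rfl
    have e1 := neg_one_pow_inversions hs h1
    have e2 := neg_one_pow_inversions hs' h2
    rw [key, Int.sign_neg, ← e1] at e2
    exact_mod_cast congrArg (Int.cast : ℤ → ℂ) e2
  · rw [wedge_of_not_injective hs, wedge_of_not_injective fun h =>
      hs ((injective_comp_equiv_iff _).1 h), neg_zero]

/-- A property of sequences that is invariant under transpositions holds for an injective sequence
once it holds for its sorted version. -/
lemma induction_swap {P : (ℕ → ℤ) → Prop}
    (hP : ∀ s, EventuallyNeg s → ∀ a b, a ≠ b → P s → P (s ∘ Equiv.swap a b))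
    {s : ℕ → ℤ} (hs : Function.Injective s) (he : EventuallyNeg s) {w : WedgeIndex}
    (hw : Set.range w.1 = Set.range s) (h : P w.1) : P s := by
  classical
  let π : Equiv.Perm ℕ := (Equiv.ofInjective s hs).trans
    ((Equiv.setCongr hw.symm).trans (Equiv.ofInjective w.1 w.2.1.injective).symm)
  have hπ : ∀ k, w.1 (π k) = s k := fun k =>
    Equiv.apply_ofInjective_symm w.2.1.injective _
  have hfix : ∀ᶠ k in Filter.atTop, π k = k := by
    filter_upwards [he, w.2.2] with k h1 h2
    exact w.2.1.injective (by rw [hπ, h1, h2])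
  -- A permutation moving finitely many points is a product of transpositions.
  have hfin : (MulAction.fixedBy ℕ π)ᶜ.Finite := by
    obtain ⟨N, hN⟩ := Filter.eventually_atTop.1 hfix
    refine (Set.finite_lt_nat N).subset fun k hk => ?_
    change k < N
    by_contra hlt
    exact hk (hN k (by omega))
  -- `EventuallyNeg` is carried along because `hP` needs it; an equivalence for all `s` passes to
  -- products and inverses.
  have key : ∀ ρ ∈ Subgroup.closure {σ : Equiv.Perm ℕ | σ.IsSwap}, ∀ s : ℕ → ℤ,
      EventuallyNeg (s ∘ ρ) ∧ P (s ∘ ρ) ↔ EventuallyNeg s ∧ P s := by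
    intro ρ hρ
    induction hρ using Subgroup.closure_induction with
    | mem σ hσ =>
      obtain ⟨a, b, hab, rfl⟩ := hσ
      refine fun s => ⟨fun ⟨h1, h2⟩ => ?_, fun ⟨h1, h2⟩ => ⟨h1.comp_swap a b, hP s h1 a b hab h2⟩⟩
      have h3 := hP _ h1 a b hab h2
      rw [Function.comp_assoc, ← Equiv.coe_trans, Equiv.swap_swap] at h3
      exact ⟨(eventuallyNeg_comp_swap_iff a b).1 h1, h3⟩
    | one => exact fun s => Iff.rfl
    | mul x y _ _ hx hy => exact fun s => (hy (s ∘ x)).trans (hx s)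
    | inv x _ ih =>
      intro s
      have := ih (s ∘ ⇑x⁻¹)
      rw [Function.comp_assoc, ← Equiv.Perm.coe_mul, inv_mul_cancel] at this
      exact this.symm
  have := ((key π (mem_closure_isSwap'.2 hfin) w.1).2 ⟨w.2.2, h⟩).2
  rwa [show w.1 ∘ π = s from funext hπ] at this

/-! ### The Leibniz rule for `Λ_k` on unsorted wedges. -/

/-- The Leibniz expansion of the action of `Λ_k` on `v_{s 0} ∧ v_{s 1} ∧ ⋯`. -/
def leibniz (k : ℤ) (s : ℕ → ℤ) : Fermionic :=
  ∑ᶠ m : ℕ, wedge (Function.update s m (s m - k))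

/-- The same transposition reindexes the slots, and each term changes sign by `wedge_comp_swap`. -/
lemma leibniz_comp_swap (k : ℤ) {s : ℕ → ℤ} (he : EventuallyNeg s) {a b : ℕ} (hab : a ≠ b) :
    leibniz k (s ∘ Equiv.swap a b) = -leibniz k s := by
  unfold leibniz
  rw [← finsum_neg_distrib, ← finsum_comp_equiv (Equiv.swap a b)]
  refine finsum_congr fun m => ?_
  rw [← wedge_comp_swap (he.update _ _) hab]
  congr 1
  ext i
  simp only [Function.comp_apply, Function.update_apply, Equiv.swap_apply_self,
    ← Equiv.apply_eq_iff_eq (Equiv.swap a b) (x := i)]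

/-- Swapping two equal factors fixes `s`, so the expansion equals its own negative. This covers the
repeated factors that a first shift may create. -/
lemma leibniz_of_not_injective (k : ℤ) {s : ℕ → ℤ} (he : EventuallyNeg s)
    (hs : ¬Function.Injective s) : leibniz k s = 0 := by
  simp only [Function.Injective, not_forall] at hs
  obtain ⟨a, b, h, hab⟩ := hs
  have h1 : s ∘ Equiv.swap a b = s := by
    ext i
    simp only [Function.comp_apply, Equiv.swap_apply_def]
    split_ifs with h2 h3 <;> simp_all
  have h2 := leibniz_comp_swap k he hab
  rw [h1] at h2
  exact self_eq_neg.1 h2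

/-- Shifting a slot in the tail repeats a factor. -/
lemma wedge_update_eq_zero {k : ℤ} (hk : k ≠ 0) {s : ℕ → ℤ} {N m : ℕ}
    (hN : ∀ j, N ≤ j → s j = -(j : ℤ)) (hm : N + k.natAbs ≤ m) :
    wedge (Function.update s m (s m - k)) = 0 := by
  refine wedge_of_not_injective fun hinj => ?_
  -- The tail slot `l` already holds `-l = s m - k`.
  obtain ⟨l, hl⟩ : ∃ l : ℕ, (l : ℤ) = m + k := ⟨(m + k).toNat, by omega⟩
  have hlm : l ≠ m := by omega
  refine hlm (hinj ?_)
  rw [Function.update_self, Function.update_of_ne hlm, hN l (by omega), hN m (by omega)]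
  omega

lemma leibniz_eq_sum {k : ℤ} (hk : k ≠ 0) {s : ℕ → ℤ} {N M : ℕ}
    (hN : ∀ j, N ≤ j → s j = -(j : ℤ)) (hM : N + k.natAbs ≤ M) :
    leibniz k s = ∑ m ∈ Finset.range M, wedge (Function.update s m (s m - k)) := by
  refine finsum_eq_sum_of_support_subset _ fun m hm => ?_
  simp only [Finset.coe_range, Set.mem_Iio]
  by_contra hlt
  exact hm (wedge_update_eq_zero hk hN (by omega))

/-- Only `i = w m - k` can contribute, since `E_{i,i+k}` needs a factor `v_{i+k}`; the sum over `i`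
becomes a sum over slots. -/
lemma Lam_single {k : ℤ} (hk : k ≠ 0) (w : WedgeIndex) :
    Lam k (Finsupp.single w 1) = leibniz k w.1 := by
  classical
  simp only [Lam, if_neg hk, Finsupp.linearCombination_single, one_smul]
  have hg : Function.Injective fun m => w.1 m - k := fun a b h =>
    w.2.1.injective (by simpa using h)
  have h1 : ∀ m, E (w.1 m - k) (w.1 m - k + k) (Finsupp.single w 1) =
      wedge (Function.update w.1 m (w.1 m - k)) :=
    fun m => E_single _ _ w m (by ring)
  rw [leibniz, ← finsum_congr h1, ← finsum_mem_range hg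
    (f := fun i => E i (i + k) (Finsupp.single w 1))]
  refine finsum_congr fun i => ?_
  by_cases hi : i ∈ Set.range fun m => w.1 m - k
  · rw [finsum_eq_if, if_pos hi]
  · rw [finsum_eq_if, if_neg hi]
    refine E_single_of_forall_ne _ _ w fun m hm => hi ⟨m, ?_⟩
    change w.1 m - k = i
    omega

/-- The Leibniz rule for `Λ_k` on wedges that need not be sorted. -/
lemma Lam_wedge {k : ℤ} (hk : k ≠ 0) {s : ℕ → ℤ} (he : EventuallyNeg s) :
    Lam k (wedge s) = leibniz k s := by
  by_cases hs : Function.Injective s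
  · obtain ⟨w, hw⟩ := WedgeIndex.exists_range_eq hs he
    refine induction_swap (P := fun s => Lam k (wedge s) = leibniz k s) ?_ hs he hw ?_
    · intro s hs a b hab h
      rw [wedge_comp_swap hs hab, leibniz_comp_swap k hs hab, map_neg, h]
    · rw [wedge_of_index, Lam_single hk]
  · rw [wedge_of_not_injective hs, leibniz_of_not_injective k he hs, map_zero]

/-! ### The commutation relations. -/

/-- The wedge with slot `m` shifted by `-k` and slot `l` shifted by `-n`. -/
def shiftTwo (s : ℕ → ℤ) (k n : ℤ) (m l : ℕ) : Fermionic :=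
  wedge (Function.update (Function.update s m (s m - k)) l
    (Function.update s m (s m - k) l - n))

lemma shiftTwo_comm (s : ℕ → ℤ) (k n : ℤ) (m l : ℕ) :
    shiftTwo s k n m l = shiftTwo s n k l m := by
  unfold shiftTwo
  by_cases h : m = l
  · subst h
    simp only [Function.update_self, Function.update_idem]
    congr 2
    ring
  · rw [Function.update_of_ne (Ne.symm h), Function.update_of_ne h, Function.update_comm h]

/-- After a shift in a slot `m < M` the tail is only known to start at `M`, so the second expansion
needs a larger cut-off. The resulting rectangle is not symmetric. -/
lemma Lam_Lam_wedge {k n : ℤ} (hk : k ≠ 0) (hn : n ≠ 0) {s : ℕ → ℤ} {N M M' : ℕ}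
    (hN : ∀ j, N ≤ j → s j = -(j : ℤ)) (hM : N + k.natAbs ≤ M) (hM' : M + n.natAbs ≤ M') :
    Lam n (Lam k (wedge s)) =
      ∑ m ∈ Finset.range M, ∑ l ∈ Finset.range M', shiftTwo s k n m l := by
  have he : EventuallyNeg s := Filter.eventually_atTop.2 ⟨N, hN⟩
  rw [Lam_wedge hk he, leibniz_eq_sum hk hN hM, map_sum]
  refine Finset.sum_congr rfl fun m hm => ?_
  rw [Finset.mem_range] at hm
  rw [Lam_wedge hn (he.update _ _), leibniz_eq_sum (N := M) hn _ hM']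
  · rfl
  · intro j hj
    rw [Function.update_of_ne (by omega), hN j (by omega)]

/-- The terms of `Λ_n Λ_k` that shift one slot before the cut-off `M` and one beyond it. -/
lemma shiftTwo_of_lt_of_le {k n : ℤ} (hk : k ≠ 0) (hn : n ≠ 0) {s : ℕ → ℤ} {N M m l : ℕ}
    (hN : ∀ j, N ≤ j → s j = -(j : ℤ)) (hM : N + k.natAbs + n.natAbs ≤ M) (hm : m < M)
    (hl : M ≤ l) :
    shiftTwo s k n m l = if n = -k ∧ (l : ℤ) = m + k then -wedge s else 0 := by
  have he : EventuallyNeg s := Filter.eventually_atTop.2 ⟨N, hN⟩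
  have hml : m ≠ l := by omega
  have hsl := hN l (by omega)
  unfold shiftTwo
  rw [Function.update_of_ne hml.symm, hsl]
  -- Slot `l` moves to the value `-j` of the tail slot `j`, a repetition unless slot `j` is the one
  -- already moved. In that case `n = -k` gives the transposition of `m` and `l`; otherwise slot `m`
  -- collides with the tail slot `j + k`.
  obtain ⟨j, hj⟩ : ∃ j : ℕ, (j : ℤ) = l + n := ⟨(l + n).toNat, by omega⟩
  have hsj := hN j (by omega)
  by_cases hjm : j = m
  · subst hjm
    by_cases hkn : n = -k
    · rw [if_pos ⟨hkn, by omega⟩, ← wedge_comp_swap he hml]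
      congr 1
      ext i
      simp only [Function.comp_apply, Function.update_apply, Equiv.swap_apply_def]
      split_ifs <;> omega
    · rw [if_neg fun h => hkn h.1]
      refine wedge_of_not_injective fun hinj => ?_
      obtain ⟨i, hi⟩ : ∃ i : ℕ, (i : ℤ) = j + k := ⟨(j + k).toNat, by omega⟩
      have hij : i ≠ j := by omega
      have hil : i ≠ l := by omega
      refine hij (hinj ?_)
      rw [Function.update_of_ne hil, Function.update_of_ne hij, Function.update_of_ne hml,
        Function.update_self, hsj, hN i (by omega)]
      omega
  · rw [if_neg (by omega)]
    refine wedge_of_not_injective fun hinj => ?_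
    have hjl : j ≠ l := by omega
    refine hjl (hinj ?_)
    rw [Function.update_self, Function.update_of_ne hjl, Function.update_of_ne hjm, hsj]
    omega

/-- For `n = -k < 0`, each of the last `k` slots `m` before `M` contributes `-wedge s`, through `l =
m + k` alone. For `k < 0` the slot `m + k` cannot reach `M`. -/
lemma sum_shiftTwo {k n : ℤ} (hk : k ≠ 0) (hn : n ≠ 0) {s : ℕ → ℤ} {N M M' : ℕ}
    (hN : ∀ j, N ≤ j → s j = -(j : ℤ)) (hM : N + k.natAbs + n.natAbs ≤ M)
    (hM' : M + k.natAbs + n.natAbs ≤ M') :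
    ∑ m ∈ Finset.range M, ∑ l ∈ Finset.Ico M M', shiftTwo s k n m l =
      if n = -k ∧ n < 0 then (n : ℂ) • wedge s else 0 := by
  have h1 : ∀ m ∈ Finset.range M, ∑ l ∈ Finset.Ico M M', shiftTwo s k n m l =
      if n = -k ∧ (M : ℤ) ≤ m + k then -wedge s else 0 := by
    intro m hm
    rw [Finset.mem_range] at hm
    split_ifs with h
    · rw [Finset.sum_eq_single (m + k).toNat]
      · rw [shiftTwo_of_lt_of_le hk hn hN hM hm (by omega), if_pos ⟨h.1, by omega⟩]
      · intro l hl hne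
        rw [Finset.mem_Ico] at hl
        rw [shiftTwo_of_lt_of_le hk hn hN hM hm hl.1, if_neg (by omega)]
      · intro hl
        rw [Finset.mem_Ico] at hl
        omega
    · refine Finset.sum_eq_zero fun l hl => ?_
      rw [Finset.mem_Ico] at hl
      rw [shiftTwo_of_lt_of_le hk hn hN hM hm hl.1, if_neg (by omega)]
  rw [Finset.sum_congr rfl h1, ← Finset.sum_filter, Finset.sum_const]
  split_ifs with h
  · have h2 : (Finset.range M).filter (fun m : ℕ => n = -k ∧ (M : ℤ) ≤ m + k) =
        Finset.Ico (M - k.natAbs) M := by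
      ext m
      simp only [Finset.mem_filter, Finset.mem_range, Finset.mem_Ico]
      omega
    have h3 : (n : ℂ) = -((M - (M - k.natAbs) : ℕ) : ℂ) := by
      rw [← Int.cast_natCast (R := ℂ), ← Int.cast_neg]
      congr 1
      omega
    rw [h2, Nat.card_Ico, h3, neg_smul, smul_neg, Nat.cast_smul_eq_nsmul]
  · rw [Finset.filter_eq_empty_iff.2, Finset.card_empty, zero_smul]
    intro m hm
    rw [Finset.mem_range] at hm
    omega

/-- The Heisenberg commutation relations on the fermionic Fock space. -/
lemma Lam_comm (n k : ℤ) (v : Fermionic) :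
    Lam n (Lam k v) - Lam k (Lam n v) = if n = -k then (n : ℂ) • v else 0 := by
  by_cases hn : n = 0
  · subst hn
    simp [Lam]
  by_cases hk : k = 0
  · subst hk
    simp [Lam, hn]
  induction v using Finsupp.induction_linear with
  | zero => simp
  | add v v' h h' =>
    simp only [map_add]
    rw [add_sub_add_comm, h, h']
    split_ifs <;> simp
  | single w c =>
    rw [← mul_one c, ← smul_eq_mul, ← Finsupp.smul_single]
    simp only [map_smul]
    rw [← smul_sub, smul_comm (n : ℂ) c, ← smul_ite_zero]
    congr 1
    rw [← wedge_of_index]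
    obtain ⟨N, hN⟩ := Filter.eventually_atTop.1 w.2.2
    set M := N + k.natAbs + n.natAbs with hM
    set M' := M + k.natAbs + n.natAbs with hM'
    rw [Lam_Lam_wedge hk hn hN (M := M) (M' := M') (by omega) (by omega),
      Lam_Lam_wedge hn hk hN (M := M) (M' := M') (by omega) (by omega)]
    -- The `M × M` squares agree by `shiftTwo_comm`. For `n = -k` exactly one of the two strips
    -- survives, the one whose outer operator has negative index.
    have hsplit : ∀ f : ℕ → Fermionic, ∑ l ∈ Finset.range M', f l =
        ∑ l ∈ Finset.range M, f l + ∑ l ∈ Finset.Ico M M', f l := fun f =>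
      (Finset.sum_range_add_sum_Ico f (by omega)).symm
    simp only [hsplit, Finset.sum_add_distrib]
    rw [sum_shiftTwo hk hn hN (by omega) (by omega), sum_shiftTwo hn hk hN (by omega) (by omega),
      Finset.sum_comm]
    simp only [shiftTwo_comm w.1 k n]
    rw [add_sub_add_left_eq_sub]
    by_cases h : n = -k
    · subst h
      rcases lt_or_gt_of_ne hk with hk | hk
      · simp [hk, hk.not_gt]
      · simp [hk, hk.not_gt]
    · have h' : ¬k = -n := by omega
      simp [h, h']
-- The Heisenberg module structure on the fermionic side.
namespace Fermionic

/-- The action of the Heisenberg algebra on the fermionic Fock space: `a_k` acts by `Λ_k` and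
`z` acts by the identity. -/
def rep : Heisenberg →ₗ[ℂ] Module.End ℂ Fermionic :=
  (Finsupp.linearCombination ℂ Lam).coprod
    (LinearMap.toSpanSingleton ℂ (Module.End ℂ Fermionic) LinearMap.id)

lemma rep_apply (x : Heisenberg) (v : Fermionic) :
    rep x v = Finsupp.linearCombination ℂ Lam x.1 v + x.2 • v := rfl

lemma linearCombination_Lam_comm (f g : ℤ →₀ ℂ) (v : Fermionic) :
    Finsupp.linearCombination ℂ Lam f (Finsupp.linearCombination ℂ Lam g v)
      - Finsupp.linearCombination ℂ Lam g (Finsupp.linearCombination ℂ Lam f v)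
      = Heisenberg.form f g • v := by
  induction f using Finsupp.induction_linear with
  | zero => simp
  | add f f' hf hf' =>
    rw [Heisenberg.form_add_left, add_smul, ← hf, ← hf']
    simp only [map_add, LinearMap.add_apply]
    abel
  | single n c =>
    induction g using Finsupp.induction_linear with
    | zero => simp
    | add g g' hg hg' =>
      rw [Heisenberg.form_add_right, add_smul, ← hg, ← hg']
      simp only [map_add, LinearMap.add_apply]
      abel
    | single k d =>
      simp only [Finsupp.linearCombination_single, LinearMap.smul_apply, map_smul]
      rw [smul_comm d c, ← smul_sub, ← smul_sub, Lam_comm, Heisenberg.form,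
        Finsupp.sum_single_index (by simp)]
      split_ifs with h
      · rw [h]
        simp only [neg_neg, Finsupp.single_eq_same, smul_smul]
        congr 1
        ring
      · rw [Finsupp.single_eq_of_ne (by omega)]
        simp

lemma rep_lie (x y : Heisenberg) (v : Fermionic) :
    rep ⁅x, y⁆ v = rep x (rep y v) - rep y (rep x v) := by
  have h := linearCombination_Lam_comm x.1 y.1 v
  have e : rep ⁅x, y⁆ v = Heisenberg.form x.1 y.1 • v := by
    rw [rep_apply, Heisenberg.bracket_def]
    simp
  rw [e, ← h]
  simp only [rep_apply, map_add, map_smul, smul_add, smul_comm x.2 y.2 v]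
  abel

instance : LieRingModule Heisenberg Fermionic where
  bracket x v := rep x v
  add_lie x y v := by
    change rep (x + y) v = _
    rw [map_add]; rfl
  lie_add x v w := map_add (rep x) v w
  leibniz_lie x y v := sub_eq_iff_eq_add.1 (rep_lie x y v).symm

instance : LieModule ℂ Heisenberg Fermionic where
  smul_lie t x v := by
    change rep (t • x) v = _
    rw [map_smul]; rfl
  lie_smul t x v := map_smul (rep x) t v

lemma lie_eq (x : Heisenberg) (v : Fermionic) :
    ⁅x, v⁆ = Finsupp.linearCombination ℂ Lam x.1 v + x.2 • v := rfl

lemma lie_a (k : ℤ) (v : Fermionic) : ⁅Heisenberg.a k, v⁆ = Lam k v := by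
  rw [lie_eq]
  simp [Heisenberg.a]

lemma lie_z (v : Fermionic) : ⁅Heisenberg.z, v⁆ = v := by
  rw [lie_eq]
  simp [Heisenberg.z]

end Fermionic

/-! ### The energy grading. -/

/-- The sequence `s` has energy `d`, that is `∑ k, (s k + k) = d`. -/
def HasEnergy (s : ℕ → ℤ) (d : ℤ) : Prop :=
  ∀ᶠ N in Filter.atTop, ∑ k ∈ Finset.range N, (s k + k) = d

lemma HasEnergy.unique {s : ℕ → ℤ} {d d' : ℤ} (h : HasEnergy s d) (h' : HasEnergy s d') :
    d = d' := by
  obtain ⟨N, h1, h2⟩ := (h.and h').exists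
  exact h1.symm.trans h2

lemma HasEnergy.update {s : ℕ → ℤ} {d : ℤ} (h : HasEnergy s d) (m : ℕ) (k : ℤ) :
    HasEnergy (Function.update s m (s m - k)) (d - k) := by
  filter_upwards [h, Filter.eventually_gt_atTop m] with N hN hm
  have hm' := Finset.mem_range.2 hm
  rw [← Finset.add_sum_erase _ _ hm'] at hN ⊢
  rw [Function.update_self, Finset.sum_congr rfl fun i hi => by
    rw [Function.update_of_ne (Finset.ne_of_mem_erase hi)]]
  omega

lemma HasEnergy.comp_swap {s : ℕ → ℤ} {d : ℤ} (h : HasEnergy s d) (a b : ℕ) :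
    HasEnergy (s ∘ Equiv.swap a b) d := by
  filter_upwards [h, Filter.eventually_gt_atTop a, Filter.eventually_gt_atTop b] with N hN ha hb
  rw [← hN, Finset.sum_add_distrib, Finset.sum_add_distrib]
  congr 1
  refine Equiv.Perm.sum_comp (Equiv.swap a b) _ s fun i hi => ?_
  rw [Finset.coe_range, Set.mem_Iio]
  by_contra hlt
  exact hi (Equiv.swap_apply_of_ne_of_ne (by omega) (by omega))

/-- The span of the basis wedges of energy `d`. -/
def energySubmodule (d : ℤ) : Submodule ℂ Fermionic :=
  Finsupp.supported ℂ ℂ {w | HasEnergy w.1 d}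

/-- Sorting does not change the energy. -/
lemma wedge_mem_energySubmodule {s : ℕ → ℤ} (he : EventuallyNeg s) {d : ℤ} (h : HasEnergy s d) :
    wedge s ∈ energySubmodule d := by
  by_cases hs : Function.Injective s
  · obtain ⟨w, hw⟩ := WedgeIndex.exists_range_eq hs he
    rw [wedge_eq hs hw]
    refine Finsupp.single_mem_supported ℂ _ ?_
    by_contra hcon
    -- `induction_swap` passes from the sorted sequence to `s`, so the opposite direction is
    -- obtained from the negated property.
    refine induction_swap (P := fun s => ¬HasEnergy s d) ?_ hs he hw hcon h
    intro s _ a b _ h1 h2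
    have := h2.comp_swap a b
    rw [Function.comp_assoc, ← Equiv.coe_trans, Equiv.swap_swap] at this
    exact h1 this
  · rw [wedge_of_not_injective hs]
    exact zero_mem _

/-- The operator `Λ_k` lowers the energy by `k`. -/
lemma Lam_mem_energySubmodule (k : ℤ) {d : ℤ} {v : Fermionic} (hv : v ∈ energySubmodule d) :
    Lam k v ∈ energySubmodule (d - k) := by
  by_cases hk : k = 0
  · simp [Lam, hk]
  · rw [energySubmodule, Finsupp.supported_eq_span_single] at hv
    induction hv using Submodule.span_induction with
    | mem v hv =>
      obtain ⟨w, hw, rfl⟩ := hv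
      rw [Lam_single hk]
      obtain ⟨N, hN⟩ := Filter.eventually_atTop.1 w.2.2
      rw [leibniz_eq_sum hk hN le_rfl]
      exact Submodule.sum_mem _ fun m _ =>
        wedge_mem_energySubmodule (EventuallyNeg.update w.2.2 _ _) (HasEnergy.update hw m k)
    | zero => simp
    | add x y _ _ hx hy => rw [map_add]; exact add_mem hx hy
    | smul c x _ hx => rw [map_smul]; exact Submodule.smul_mem _ c hx

lemma vacuum_mem_energySubmodule : vacuum ∈ energySubmodule 0 :=
  Finsupp.single_mem_supported ℂ _ (Filter.Eventually.of_forall fun N => by simp [vacuumIndex])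

/-- Slot `m` moves to `-(m + k)`, which slot `m + k` already holds. -/
lemma Lam_vacuum {k : ℤ} (hk : 0 < k) : Lam k vacuum = 0 := by
  rw [vacuum, Lam_single hk.ne', leibniz_eq_sum hk.ne' (s := vacuumIndex.1) (N := 0)
    (fun _ _ => rfl) le_rfl]
  exact Finset.sum_eq_zero fun m _ => wedge_of_not_injective fun hinj => by
    have h : m + k.toNat ≠ m := by omega
    refine h (hinj ?_)
    rw [Function.update_self, Function.update_of_ne h]
    simp only [vacuumIndex]
    push_cast
    omega

/-! ### Counting wedges by monomials. -/

/-- The exponents `i_{n-1} - i_n - 1` of the monomial attached to a basis wedge. -/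
def exponents (w : WedgeIndex) : ℕ+ →₀ ℕ :=
  Finsupp.ofSupportFinite (fun n => (w.1 n.natPred - w.1 (n.natPred + 1) - 1).toNat) (by
    obtain ⟨N, hN⟩ := Filter.eventually_atTop.1 w.2.2
    refine ((Set.finite_lt_nat N).preimage (f := PNat.natPred)
      PNat.natPred_injective.injOn).subset fun n hn => ?_
    change n.natPred < N
    by_contra hlt
    refine hn ?_
    simp only
    rw [hN _ (by omega), hN _ (by omega)]
    omega)

lemma exponents_succPNat (w : WedgeIndex) (n : ℕ) :
    (exponents w n.succPNat : ℤ) = w.1 n - w.1 (n + 1) - 1 := by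
  have h : exponents w n.succPNat = (w.1 n - w.1 (n + 1) - 1).toNat := by
    simp [exponents, Finsupp.ofSupportFinite_coe]
  have := w.2.1 (Nat.lt_succ_self n)
  rw [Nat.succ_eq_add_one] at this
  omega

lemma exponents_injective : Function.Injective exponents := by
  intro w w' h
  obtain ⟨N, hN⟩ := Filter.eventually_atTop.1 (w.2.2.and w'.2.2)
  -- The exponents fix the consecutive differences; the induction descends from the common tail.
  have key : ∀ j n, n + j = N → w.1 n = w'.1 n := by
    intro j
    induction j with
    | zero => intro n hn; rw [(hN n (by omega)).1, (hN n (by omega)).2]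
    | succ j ih =>
      intro n hn
      have h1 := ih (n + 1) (by omega)
      have h2 := exponents_succPNat w n
      have h3 := exponents_succPNat w' n
      rw [h] at h2
      omega
  refine Subtype.ext (funext fun n => ?_)
  rcases le_total n N with hn | hn
  · exact key (N - n) n (by omega)
  · rw [(hN n hn).1, (hN n hn).2]

/-- The weight `∑ n c_n` of a monomial `∏ x_n ^ c_n`. -/
abbrev weight : (ℕ+ →₀ ℕ) →+ ℕ := Finsupp.weight fun n : ℕ+ => (n : ℕ)

/-- Abel summation for `λ_n = w n + n`; the boundary term `N λ_N` vanishes in the tail. -/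
lemma hasEnergy_weight (w : WedgeIndex) : HasEnergy w.1 (weight (exponents w)) := by
  have habel : ∀ N : ℕ, ∑ n ∈ Finset.range N, (n + 1 : ℤ) * (w.1 n - w.1 (n + 1) - 1) =
      ∑ n ∈ Finset.range N, (w.1 n + n) - N * (w.1 N + N) := by
    intro N
    induction N with
    | zero => simp
    | succ N ih =>
      rw [Finset.sum_range_succ, Finset.sum_range_succ, ih]
      push_cast
      ring
  filter_upwards [w.2.2, Filter.eventually_forall_ge_atTop.2 w.2.2] with N hN hN'
  have h1 : weight (exponents w) =
      ∑ n ∈ Finset.range N, exponents w n.succPNat * (n + 1) := by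
    rw [Finsupp.weight_apply, Finsupp.sum_of_support_subset (s := (Finset.range N).map
      ⟨Nat.succPNat, Nat.succPNat_injective⟩), Finset.sum_map]
    · simp
    · intro n hn
      rw [Finsupp.mem_support_iff] at hn
      rw [Finset.mem_map]
      refine ⟨n.natPred, ?_, by simp⟩
      rw [Finset.mem_range]
      by_contra hlt
      have h2 := exponents_succPNat w n.natPred
      rw [hN' _ (by omega), hN' _ (by omega), PNat.succPNat_natPred] at h2
      push_cast at h2
      omega
    · simp
  rw [h1]
  push_cast
  simp only [exponents_succPNat, mul_comm _ ((_ : ℤ) + 1)]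
  rw [habel, hN]
  ring

lemma finite_weight_eq (d : ℕ) : {c : ℕ+ →₀ ℕ | weight c = d}.Finite := by
  classical
  refine ((Finset.Icc 1 (d.succPNat)).finsupp fun _ => Finset.range (d + 1)).finite_toSet.subset ?_
  intro c hc
  have h : ∀ n, c n * n ≤ d := by
    intro n
    rw [← show weight c = d from hc, Finsupp.weight_apply, Finsupp.sum]
    by_cases hn : n ∈ c.support
    · exact Finset.single_le_sum (f := fun i : ℕ+ => c i • (i : ℕ)) (fun _ _ => Nat.zero_le _) hn
    · simp [Finsupp.notMem_support_iff.1 hn]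
  rw [Finset.mem_coe, Finset.mem_finsupp_iff]
  refine ⟨fun n hn => ?_, fun n _ => ?_⟩
  · rw [Finsupp.mem_support_iff] at hn
    rw [Finset.mem_Icc, ← PNat.coe_le_coe n, Nat.succPNat_coe]
    have := h n
    exact ⟨one_le, by nlinarith [Nat.pos_of_ne_zero hn]⟩
  · rw [Finset.mem_range]
    have := h n
    have := n.pos
    nlinarith

/-! ### The map from polynomials to the fermionic space. -/

open MvPolynomial

lemma Lam_neg_comm (m n : ℕ+) (v : Fermionic) :
    Lam (-(m : ℤ)) (Lam (-(n : ℤ)) v) = Lam (-(n : ℤ)) (Lam (-(m : ℤ)) v) := by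
  have := m.pos
  have := n.pos
  rw [← sub_eq_zero, Lam_comm, if_neg (by omega)]

/-- The operator `Λ_{-n} / n`, by which `x_n` acts on the fermionic Fock space. -/
def creation (n : ℕ+) : Module.End ℂ Fermionic := (n : ℂ)⁻¹ • Lam (-(n : ℤ))

lemma creation_mul_comm (m n : ℕ+) : creation m * creation n = creation n * creation m := by
  refine LinearMap.ext fun v => ?_
  simp only [creation, Module.End.mul_apply, LinearMap.smul_apply, map_smul, Lam_neg_comm m n]
  rw [smul_comm]

/-- `aeval` needs a commutative target, so polynomials are evaluated in this subalgebra of the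
endomorphisms. -/
instance : IsMulCommutative (Algebra.adjoin ℂ (Set.range creation)) :=
  Algebra.isMulCommutative_adjoin ℂ (by
    rintro _ ⟨m, rfl⟩ _ ⟨n, rfl⟩
    exact creation_mul_comm m n)

open scoped IsMulCommutative in
/-- The action of polynomials in the creation operators on the fermionic Fock space. -/
def polyAction : MvPolynomial ℕ+ ℂ →ₐ[ℂ] Module.End ℂ Fermionic :=
  (Algebra.adjoin ℂ (Set.range creation)).val.comp
    (aeval fun n => (⟨creation n, Algebra.subset_adjoin ⟨n, rfl⟩⟩ :
      Algebra.adjoin ℂ (Set.range creation)))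

open scoped IsMulCommutative in
lemma polyAction_X (n : ℕ+) : polyAction (X n) = creation n := by
  simp [polyAction]

/-- The map `p ↦ p(Λ_{-1}, Λ_{-2} / 2, …) v_∅` from the bosonic to the fermionic Fock space. -/
def toFermionic : MvPolynomial ℕ+ ℂ →ₗ[ℂ] Fermionic :=
  (LinearMap.applyₗ vacuum).comp polyAction.toLinearMap

lemma toFermionic_apply (p : MvPolynomial ℕ+ ℂ) : toFermionic p = polyAction p vacuum := rfl

lemma toFermionic_one : toFermionic 1 = vacuum := by
  simp [toFermionic_apply]

lemma toFermionic_X_mul (n : ℕ+) (p : MvPolynomial ℕ+ ℂ) :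
    toFermionic (X n * p) = creation n (toFermionic p) := by
  simp [toFermionic_apply, polyAction_X]

lemma Lam_neg_toFermionic (n : ℕ+) (p : MvPolynomial ℕ+ ℂ) :
    Lam (-(n : ℤ)) (toFermionic p) = toFermionic ((n : ℂ) • (X n * p)) := by
  rw [map_smul, toFermionic_X_mul, creation, LinearMap.smul_apply, smul_smul,
    mul_inv_cancel₀ (by exact_mod_cast n.ne_zero), one_smul]

/-- `Λ_n` kills the vacuum and satisfies `[Λ_n, Λ_{-m} / m] = δ_{n,m}`, the rules that determine
`∂/∂x_n`. -/
lemma Lam_pos_toFermionic (n : ℕ+) (p : MvPolynomial ℕ+ ℂ) :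
    Lam (n : ℤ) (toFermionic p) = toFermionic (pderiv n p) := by
  classical
  induction p using MvPolynomial.induction_on with
  | C c =>
    rw [pderiv_C, map_zero, ← mul_one (C c), ← smul_eq_C_mul, map_smul, map_smul,
      toFermionic_one, Lam_vacuum (by exact_mod_cast n.pos), smul_zero]
  | add p q hp hq => simp only [map_add, hp, hq]
  | mul_X p m ih =>
    rw [mul_comm p, pderiv_mul, map_add, toFermionic_X_mul, toFermionic_X_mul, ← ih, creation,
      LinearMap.smul_apply, LinearMap.smul_apply, map_smul, pderiv_X]
    have h := Lam_comm n (-(m : ℤ)) (toFermionic p)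
    rw [sub_eq_iff_eq_add] at h
    rw [h, smul_add, neg_neg]
    congr 1
    by_cases hmn : n = m
    · subst hmn
      simp [smul_smul]
    · have : (n : ℤ) ≠ m := by exact_mod_cast hmn
      simp [this, Ne.symm hmn]

/-- A nonzero space of polynomials that is closed under partial derivatives contains `1`. -/
lemma one_mem_of_pderiv_mem {S : Submodule ℂ (MvPolynomial ℕ+ ℂ)}
    (hS : ∀ n, ∀ p ∈ S, pderiv n p ∈ S) (h : S ≠ ⊥) : 1 ∈ S := by
  have key : ∀ d : ℕ, ∀ p ∈ S, p ≠ 0 → p.totalDegree ≤ d → 1 ∈ S := by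
    intro d
    induction d with
    | zero =>
      intro p hp hp0 hd
      rw [Nat.le_zero, totalDegree_eq_zero_iff_eq_C] at hd
      have hc : coeff 0 p ≠ 0 := fun hc => hp0 (by rw [hd, hc, C_0])
      have := S.smul_mem (coeff 0 p)⁻¹ hp
      rwa [hd, coeff_C, if_pos rfl, smul_eq_C_mul, ← C_mul, inv_mul_cancel₀ hc, C_1] at this
    | succ d ih =>
      intro p hp hp0 hd
      by_cases hex : ∃ n, pderiv n p ≠ 0
      · obtain ⟨n, hn⟩ := hex
        refine ih _ (hS n p hp) hn ?_
        refine Finset.sup_le fun m hm => ?_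
        rw [mem_support_iff, coeff_pderiv] at hm
        have h1 := le_totalDegree (mem_support_iff.2 (left_ne_zero_of_mul hm))
        change (m + Finsupp.single n 1).degree ≤ _ at h1
        rw [map_add, Finsupp.degree_single] at h1
        change m.degree ≤ d
        omega
      -- All derivatives vanish, so in characteristic zero only the constant monomial can occur in
      -- `p`.
      · push Not at hex
        refine ih p hp hp0 ?_
        refine Finset.sup_le fun m hm => ?_
        by_cases hm0 : m = 0
        · simp [hm0]
        · obtain ⟨n, hn⟩ := Finsupp.ne_iff.1 hm0
          have hle : Finsupp.single n 1 ≤ m := by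
            rw [Finsupp.single_le_iff]
            exact Nat.one_le_iff_ne_zero.2 hn
          have h1 := coeff_pderiv (i := n) p (m - Finsupp.single n 1)
          rw [hex, coeff_zero, tsub_add_cancel_of_le hle] at h1
          rcases mul_eq_zero.1 h1.symm with h2 | h2
          · exact absurd h2 (mem_support_iff.1 hm)
          · exact absurd h2 (Nat.cast_add_one_ne_zero _)
  obtain ⟨p, hp, hp0⟩ := Submodule.exists_mem_ne_zero_of_ne_bot h
  exact key _ p hp hp0 le_rfl

lemma vacuum_ne_zero : vacuum ≠ 0 := by
  simp [vacuum]

lemma toFermionic_injective : Function.Injective toFermionic := by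
  rw [← LinearMap.ker_eq_bot]
  by_contra h
  have := one_mem_of_pderiv_mem (fun n p hp => by
    rw [LinearMap.mem_ker] at hp ⊢
    rw [← Lam_pos_toFermionic, hp, map_zero]) h
  rw [LinearMap.mem_ker, toFermionic_one] at this
  exact vacuum_ne_zero this

/-- Each factor `x_n` acts by a multiple of `Λ_{-n}`, which raises the energy by `n`. -/
lemma toFermionic_monomial_mem (c : ℕ+ →₀ ℕ) :
    toFermionic (monomial c 1) ∈ energySubmodule (weight c) := by
  have key : ∀ (d : ℤ) (p : MvPolynomial ℕ+ ℂ), toFermionic p ∈ energySubmodule d →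
      toFermionic (monomial c 1 * p) ∈ energySubmodule (d + weight c) := by
    induction c using Finsupp.induction_linear with
    | zero => intro d p hp; simpa using hp
    | add c c' h h' =>
      intro d p hp
      have := h _ _ (h' d p hp)
      rw [← mul_assoc, monomial_mul, one_mul] at this
      convert this using 2
      rw [map_add]
      push_cast
      ring
    | single n j =>
      intro d p hp
      induction j with
      | zero => simpa using hp
      | succ j ih =>
        have h1 := Lam_mem_energySubmodule (-(n : ℤ)) ih
        rw [Finsupp.single_add, ← one_mul (1 : ℂ), ← monomial_mul, mul_comm (monomial _ _),
          mul_assoc]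
        change toFermionic (X n * _) ∈ _
        rw [toFermionic_X_mul, creation, LinearMap.smul_apply]
        refine Submodule.smul_mem _ _ ?_
        convert h1 using 2
        simp [Finsupp.weight_single]
        ring
  have := key 0 1 (by rw [toFermionic_one]; exact vacuum_mem_energySubmodule)
  rwa [mul_one, zero_add] at this

/-- A linearly independent family in the span of at most as many vectors spans. -/
lemma span_range_le_of_linearIndependent {K V ι κ : Type*} [Field K] [AddCommGroup V] [Module K V]
    [Fintype ι] [Fintype κ] {b : ι → V} {e : κ → V} (hb : LinearIndependent K b)
    (hmem : ∀ i, b i ∈ Submodule.span K (Set.range e)) (hcard : Fintype.card κ ≤ Fintype.card ι) :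
    Submodule.span K (Set.range e) ≤ Submodule.span K (Set.range b) := by
  have : FiniteDimensional K (Submodule.span K (Set.range e)) :=
    FiniteDimensional.span_of_finite K (Set.finite_range e)
  refine (Submodule.eq_of_le_of_finrank_le (Submodule.span_le.2 ?_) ?_).ge
  · rintro _ ⟨i, rfl⟩
    exact hmem i
  · rw [finrank_span_eq_card hb]
    exact (finrank_range_le_card e).trans hcard

lemma linearIndependent_toFermionic_monomial :
    LinearIndependent ℂ fun c : ℕ+ →₀ ℕ => toFermionic (monomial c 1) := by
  have h := (basisMonomials ℕ+ ℂ).linearIndependent.map' toFermionic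
    (LinearMap.ker_eq_bot.2 toFermionic_injective)
  rw [coe_basisMonomials] at h
  exact h

/-- In each energy, the wedges are at most as many as the monomials, so the images of the monomials
span. -/
lemma energySubmodule_le_range (d : ℕ) : energySubmodule d ≤ LinearMap.range toFermionic := by
  have := (finite_weight_eq d).fintype
  -- Injectivity suffices: independence of the monomial images supplies the reverse inequality.
  let f : {w : WedgeIndex | HasEnergy w.1 (d : ℤ)} → {c : ℕ+ →₀ ℕ | weight c = d} := fun w =>
    ⟨exponents w.1, by exact_mod_cast (hasEnergy_weight w.1).unique w.2⟩
  have hf : Function.Injective f := fun a b h =>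
    Subtype.ext (exponents_injective (Subtype.ext_iff.1 h))
  have := Finite.of_injective f hf
  have := Fintype.ofFinite {w : WedgeIndex | HasEnergy w.1 (d : ℤ)}
  have hli := linearIndependent_toFermionic_monomial.comp
    (fun c : {c : ℕ+ →₀ ℕ | weight c = d} => c.1) Subtype.val_injective
  have hspan : energySubmodule d = Submodule.span ℂ
      (Set.range fun w : {w : WedgeIndex | HasEnergy w.1 (d : ℤ)} => Finsupp.single w.1 1) := by
    rw [energySubmodule, Finsupp.supported_eq_span_single, Set.image_eq_range]
  have hmem : ∀ c : {c : ℕ+ →₀ ℕ | weight c = d},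
      toFermionic (monomial c.1 1) ∈ energySubmodule d := fun c => by
    have := toFermionic_monomial_mem c.1
    have hc : weight c.1 = d := c.2
    rwa [hc] at this
  rw [hspan] at hmem ⊢
  refine (span_range_le_of_linearIndependent hli hmem
    (Fintype.card_le_of_injective f hf)).trans ?_
  rw [Submodule.span_le]
  rintro _ ⟨c, rfl⟩
  exact LinearMap.mem_range_self toFermionic (monomial c.1 1)

/-- By `hasEnergy_weight` every wedge has energy in `ℕ`, so the graded pieces already treated
exhaust the space. -/
lemma toFermionic_surjective : Function.Surjective toFermionic := by
  rw [← LinearMap.range_eq_top, eq_top_iff, ← Finsupp.supported_univ,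
    Finsupp.supported_eq_span_single, Submodule.span_le]
  rintro _ ⟨w, -, rfl⟩
  exact energySubmodule_le_range _ (Finsupp.single_mem_supported ℂ _ (hasEnergy_weight w))

/-! ### The module isomorphism, uniqueness and irreducibility. -/

/-- A space of polynomials that contains `1` and is closed under multiplication by the variables
contains all polynomials. -/
lemma eq_top_of_X_mul_mem {S : Submodule ℂ (MvPolynomial ℕ+ ℂ)} (h1 : 1 ∈ S)
    (hS : ∀ n, ∀ p ∈ S, X n * p ∈ S) : S = ⊤ := by
  refine eq_top_iff.2 fun p _ => ?_
  induction p using MvPolynomial.induction_on with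
  | C c => simpa [smul_eq_C_mul] using S.smul_mem c h1
  | add p q hp hq => exact S.add_mem (hp trivial) (hq trivial)
  | mul_X p n hp => rw [mul_comm]; exact hS n p (hp trivial)

lemma toFermionic_op (k : ℤ) (p : MvPolynomial ℕ+ ℂ) :
    toFermionic (Bosonic.op 0 1 k p) = Lam k (toFermionic p) := by
  rcases lt_trichotomy k 0 with h | rfl | h
  · obtain ⟨n, rfl⟩ : ∃ n : ℕ+, k = -(n : ℤ) :=
      ⟨⟨k.natAbs, by omega⟩, by rw [PNat.mk_coe]; omega⟩
    rw [Bosonic.op_neg, Lam_neg_toFermionic, one_mul]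
  · simp [Bosonic.op_zero, Lam]
  · obtain ⟨n, rfl⟩ : ∃ n : ℕ+, k = (n : ℤ) := ⟨⟨k.natAbs, by omega⟩, by rw [PNat.mk_coe]; omega⟩
    rw [Bosonic.op_pos, Lam_pos_toFermionic]

lemma toFermionic_rep (x : Heisenberg) (p : MvPolynomial ℕ+ ℂ) :
    toFermionic (Bosonic.rep 0 1 x p) = ⁅x, toFermionic p⁆ := by
  rw [Bosonic.rep_apply, map_add, map_smul, mul_one, Fermionic.lie_eq]
  congr 1
  rw [Finsupp.linearCombination_apply, Finsupp.linearCombination_apply, Finsupp.sum, Finsupp.sum,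
    LinearMap.sum_apply, LinearMap.sum_apply, map_sum]
  refine Finset.sum_congr rfl fun k _ => ?_
  rw [LinearMap.smul_apply, LinearMap.smul_apply, map_smul, toFermionic_op]

/-- The identity map from polynomials to the bosonic Fock space. -/
def toBosonic : MvPolynomial ℕ+ ℂ ≃ₗ[ℂ] Bosonic 0 1 := LinearEquiv.refl ℂ (MvPolynomial ℕ+ ℂ)

lemma lie_toBosonic (n : ℕ+) (p : MvPolynomial ℕ+ ℂ) :
    ⁅Heisenberg.a (n : ℤ), toBosonic p⁆ = toBosonic (pderiv n p) :=
  (Bosonic.lie_a 0 1 n (toBosonic p)).trans (Bosonic.op_pos 0 1 n p)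

lemma toBosonic_X_mul (n : ℕ+) (p : MvPolynomial ℕ+ ℂ) :
    toBosonic (X n * p) = (n : ℂ)⁻¹ • ⁅Heisenberg.a (-(n : ℤ)), toBosonic p⁆ := by
  have h : ⁅Heisenberg.a (-(n : ℤ)), toBosonic p⁆ = toBosonic ((n : ℂ) • (X n * p)) := by
    refine (Bosonic.lie_a 0 1 _ (toBosonic p)).trans ((Bosonic.op_neg 0 1 n p).trans ?_)
    rw [one_mul]
    rfl
  rw [h, map_smul, inv_smul_smul₀ (Nat.cast_ne_zero.2 n.ne_zero)]

/-- The boson-fermion correspondence, from the bosonic to the fermionic side. -/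
def bosonicEquivFermionic : Bosonic 0 1 ≃ₗ⁅ℂ, Heisenberg⁆ Fermionic :=
  { toBosonic.symm.trans
      (LinearEquiv.ofBijective toFermionic ⟨toFermionic_injective, toFermionic_surjective⟩) with
    map_lie' := fun {x p} => toFermionic_rep x (toBosonic.symm p) }

lemma bosonicEquivFermionic_one : bosonicEquivFermionic 1 = vacuum := toFermionic_one

/-- An endomorphism of the bosonic Fock space that fixes `1` is the identity. -/
lemma bosonic_hom_apply (f : Bosonic 0 1 →ₗ⁅ℂ, Heisenberg⁆ Bosonic 0 1) (h1 : f 1 = 1)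
    (p : Bosonic 0 1) : f p = p := by
  have hS : LinearMap.eqLocus ((f : Bosonic 0 1 →ₗ[ℂ] Bosonic 0 1) ∘ₗ toBosonic.toLinearMap)
      toBosonic.toLinearMap = ⊤ := by
    refine eq_top_of_X_mul_mem h1 fun n p (hp : f (toBosonic p) = toBosonic p) => ?_
    change f (toBosonic (X n * p)) = toBosonic (X n * p)
    rw [toBosonic_X_mul, map_smul, LieModuleHom.map_lie, hp]
  obtain ⟨q, rfl⟩ := toBosonic.surjective p
  exact LinearMap.congr_fun (LinearMap.eqLocus_eq_top.1 hS) q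

/-- The `a_n` with `n > 0` differentiate a nonzero element down to `1`, and the `a_{-n}` rebuild
every polynomial. -/
lemma bosonic_isIrreducible : LieModule.IsIrreducible ℂ Heisenberg (Bosonic 0 1) := by
  have : Nontrivial (Bosonic 0 1) := inferInstanceAs (Nontrivial (MvPolynomial ℕ+ ℂ))
  refine LieModule.IsIrreducible.mk fun N hN => ?_
  have hmem : ∀ p, p ∈ N.toSubmodule.comap toBosonic.toLinearMap ↔ toBosonic p ∈ N :=
    fun _ => Iff.rfl
  have hS : N.toSubmodule.comap toBosonic.toLinearMap = ⊤ := by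
    refine eq_top_of_X_mul_mem (one_mem_of_pderiv_mem (fun n p hp => ?_) fun h => hN ?_)
      fun n p hp => ?_
    · rw [hmem, ← lie_toBosonic]
      exact N.lie_mem hp
    · rw [LieSubmodule.eq_bot_iff]
      intro v hv
      obtain ⟨q, rfl⟩ := toBosonic.surjective v
      rw [← hmem, h, Submodule.mem_bot] at hv
      rw [hv, map_zero]
    · rw [hmem, toBosonic_X_mul]
      exact N.smul_mem _ (N.lie_mem hp)
  refine eq_top_iff.2 fun v _ => ?_
  obtain ⟨q, rfl⟩ := toBosonic.surjective v
  rw [← hmem, hS]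
  trivial

lemma fermionic_isIrreducible : LieModule.IsIrreducible ℂ Heisenberg Fermionic := by
  have := bosonic_isIrreducible
  have : Nontrivial Fermionic := ⟨vacuum, 0, vacuum_ne_zero⟩
  refine LieModule.IsIrreducible.mk fun N hN => ?_
  have hmem : ∀ p, p ∈ N.comap bosonicEquivFermionic.toLieModuleHom ↔
      bosonicEquivFermionic p ∈ N := fun _ => Iff.rfl
  rcases eq_bot_or_eq_top (N.comap bosonicEquivFermionic.toLieModuleHom) with h | h
  · refine absurd ((LieSubmodule.eq_bot_iff N).2 fun v hv => ?_) hN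
    obtain ⟨p, rfl⟩ := bosonicEquivFermionic.surjective v
    rw [← hmem, h, LieSubmodule.mem_bot] at hv
    rw [hv]
    exact map_zero bosonicEquivFermionic.toLieModuleHom
  · refine eq_top_iff.2 fun v _ => ?_
    obtain ⟨p, rfl⟩ := bosonicEquivFermionic.surjective v
    rw [← hmem, h]
    exact LieSubmodule.mem_top p

end BosonFermion

end

theorem mainTheorem8 :
    ∃ (_ : LieRingModule BosonFermion.Heisenberg BosonFermion.Fermionic)
      (_ : LieModule ℂ BosonFermion.Heisenberg BosonFermion.Fermionic),
      (∀ (k : ℤ) (v : BosonFermion.Fermionic),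
        ⁅BosonFermion.Heisenberg.a k, v⁆ = BosonFermion.Lam k v) ∧
      (∀ v : BosonFermion.Fermionic, ⁅BosonFermion.Heisenberg.z, v⁆ = v) ∧
      (∃! σ : BosonFermion.Fermionic ≃ₗ⁅ℂ, BosonFermion.Heisenberg⁆ BosonFermion.Bosonic 0 1,
        σ BosonFermion.vacuum = 1) ∧
      LieModule.IsIrreducible ℂ BosonFermion.Heisenberg BosonFermion.Fermionic := by
  open BosonFermion in
  refine ⟨inferInstance, inferInstance, Fermionic.lie_a, Fermionic.lie_z,
    ⟨bosonicEquivFermionic.symm, ?_, fun σ hσ => ?_⟩, fermionic_isIrreducible⟩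
  · change bosonicEquivFermionic.symm vacuum = 1
    rw [← bosonicEquivFermionic_one]
    exact bosonicEquivFermionic.symm_apply_apply 1
  -- Composing `σ` with `bosonicEquivFermionic` gives an endomorphism of the bosonic space fixing
  -- `1`, hence the identity.
  · refine LieModuleEquiv.ext _ _ fun v => ?_
    obtain ⟨p, rfl⟩ := bosonicEquivFermionic.surjective v
    rw [LieModuleEquiv.symm_apply_apply]
    refine bosonic_hom_apply
      (σ.toLieModuleHom.comp bosonicEquivFermionic.toLieModuleHom) ?_ p
    change σ (bosonicEquivFermionic 1) = 1
    rw [bosonicEquivFermionic_one]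
    exact hσ
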